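/- Consider algebras $\langle A,\wedge,\vee,\otimes,\oplus,\neg\rangle$ with nonempty universe, four binary operations and one unary operation. A \emph{bilattice} is such an algebra in which $\langle A,\wedge,\vee\rangle$ and $\langle A,\otimes,\oplus\rangle$ are lattices, with orders $\leq_t$ and $\leq_k$ respectively, and such that $a\leq_t b$ implies $\neg b\leq_t\neg a$, $a\leq_k b$ implies $\neg a\leq_k\neg b$, and $\neg\neg a=a$. It is \emph{distributive} if $x\circ(y\bullet z)=(x\circ y)\bullet(x\circ z)$ holds for all distinct $\circ,\bullet\in\{\wedge,\vee,\otimes,\oplus\}$; $\mathsf{DBiLat}$ is the class of distributive bilattices. $\mathcal{FOUR}$ is the bilattice on $\{\bot,\mathsf f,\mathsf t,\top\}$ in which $\mathsf f<_t\bot,\top<_t\mathsf t$ with $\bot,\top$ incomparable in $\leq_t$, $\bot<_k\mathsf f,\mathsf t<_k\top$ with $\mathsf f,\mathsf t$ incomparable in $\leq_k$, and $\neg$ exchanges $\mathsf t$ and $\mathsf f$ and fixes $\bot$ and $\top$. Let $Fm$ be the algebra of formulas in the language $\{\wedge,\vee,\otimes,\oplus,\neg\}$ over a countably infinite set of variables.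 The logic $\mathcal{LB}$ is the consequence relation on $Fm$ given by $\Gamma\vDash_{\mathcal{LB}}\varphi$ iff every homomorphism $h\colon Fm\to\mathcal{FOUR}$ with $h[\Gamma]\subseteq\{\mathsf t,\top\}$ satisfies $h(\varphi)\in\{\mathsf t,\top\}$. A subset $F$ of an algebra $A$ is an \emph{$\mathcal{LB}$-filter} if, whenever $\Gamma\vDash_{\mathcal{LB}}\varphi$, every homomorphism $h\colon Fm\to A$ with $h[\Gamma]\subseteq F$ satisfies $h(\varphi)\in F$. A congruence $\theta$ of $A$ is \emph{compatible} with $F\subseteq A$ if $a\in F$ and $\langle a,b\rangle\in\theta$ imply $b\in F$. Let $\mathbf{Alg}^{*}\mathcal{LB}$ be the class of algebras $A$ that have an $\mathcal{LB}$-filter $F$ such that the greatest congruence of $A$ compatible with $F$ is the identity. Let $\mathbf{Alg}\,\mathcal{LB}$ be the class of algebras $A$ that have a family $\mathcal C$ of $\mathcal{LB}$-filters, closed under arbitrary intersections and containing $A$, such that the greatest congruence of $A$ compatible with all members of $\mathcal C$ is the identity. Then $\mathbf{Alg}\,\mathcal{LB}$ is the variety generated by $\mathcal{FOUR}$ (the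 smallest class of algebras that contains $\mathcal{FOUR}$ and is closed under homomorphic images, subalgebras and direct products), and this variety is the variety $\mathsf{DBiLat}$ of distributive bilattices: $$\mathbf{Alg}\,\mathcal{LB}=V(\mathcal{FOUR})=\mathsf{DBiLat}.$$ Moreover, $\mathbf{Alg}^{*}\mathcal{LB}\subsetneq\mathbf{Alg}\,\mathcal{LB}$. -/

import Mathlib

universe u v

namespace Bilat

/-! ### Algebras in the language `∧, ∨, ⊗, ⊕, ¬` -/

/-- The four binary connectives: `∧, ∨` (truth lattice) and `⊗, ⊕` (knowledge lattice). -/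
inductive Conn : Type
  | tand
  | tor
  | kand
  | kor

/-- Operations of an algebra of the type `∧, ∨, ⊗, ⊕, ¬` on the set `A` (no laws). -/
class Ops (A : Type u) : Type u where
  op : Conn → A → A → A
  neg : A → A

/-- A homomorphism of algebras of this type. -/
structure IsHom {A : Type u} {B : Type v} [Ops A] [Ops B] (h : A → B) : Prop where
  map_op : ∀ (c : Conn) (x y : A), h (Ops.op c x y) = Ops.op c (h x) (h y)
  map_neg : ∀ x : A, h (Ops.neg x) = Ops.neg (h x)

/-- A congruence: an equivalence relation that respects all operations. -/
structure IsCongruence {A : Type u} [Ops A] (θ : Setoid A) : Prop where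
  op : ∀ (c : Conn) {x x' y y' : A}, θ x x' → θ y y' → θ (Ops.op c x y) (Ops.op c x' y')
  neg : ∀ {x x' : A}, θ x x' → θ (Ops.neg x) (Ops.neg x')

/-- The direct product, with coordinatewise operations. -/
instance instOpsPi {I : Type v} (A : I → Type u) [∀ i, Ops (A i)] : Ops (∀ i, A i) where
  op c x y := fun i => Ops.op c (x i) (y i)
  neg x := fun i => Ops.neg (x i)

/-- An algebra of this type: a nonempty set with the five operations. -/
structure Alg : Type (u + 1) where
  carrier : Type u
  [nonempty : Nonempty carrier]
  [ops : Ops carrier]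

attribute [instance] Alg.nonempty Alg.ops

/-- The direct product of a family of algebras. -/
def Alg.prod {I : Type u} (A : I → Alg.{u}) : Alg.{u} where
  carrier := ∀ i, (A i).carrier

/-! ### Bilattices -/

/-- `⟨A, meet, join⟩` is a lattice (as an algebra). -/
structure IsLatticeAlg {A : Type u} (meet join : A → A → A) : Prop where
  meet_comm : ∀ x y, meet x y = meet y x
  join_comm : ∀ x y, join x y = join y x
  meet_assoc : ∀ x y z, meet (meet x y) z = meet x (meet y z)
  join_assoc : ∀ x y z, join (join x y) z = join x (join y z)
  meet_join : ∀ x y, meet x (join x y) = x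
  join_meet : ∀ x y, join x (meet x y) = x

/-- The truth order. -/
def LeT {A : Type u} [Ops A] (a b : A) : Prop := Ops.op .tand a b = a

/-- The knowledge order. -/
def LeK {A : Type u} [Ops A] (a b : A) : Prop := Ops.op .kand a b = a

/-- Bilattices: two lattices and a negation that is an involution, reverses the truth order and
preserves the knowledge order. -/
structure IsBilattice (A : Type u) [Ops A] : Prop where
  truth_lattice : IsLatticeAlg (A := A) (Ops.op .tand) (Ops.op .tor)
  knowledge_lattice : IsLatticeAlg (A := A) (Ops.op .kand) (Ops.op .kor)
  neg_leT : ∀ a b : A, LeT a b → LeT (Ops.neg b) (Ops.neg a)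
  neg_leK : ∀ a b : A, LeK a b → LeK (Ops.neg a) (Ops.neg b)
  neg_neg : ∀ a : A, Ops.neg (Ops.neg a) = a

/-- Distributive bilattices: all twelve distributive laws between the four lattice operations. -/
structure IsDistributiveBilattice (A : Type u) [Ops A] : Prop extends IsBilattice A where
  distrib : ∀ c d : Conn, c ≠ d → ∀ x y z : A,
    Ops.op c x (Ops.op d y z) = Ops.op d (Ops.op c x y) (Ops.op c x z)

/-- The class of distributive bilattices. -/
def DBiLat : Set Alg.{u} := {A | IsDistributiveBilattice A.carrier}

/-! ### The four-element bilattice -/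

/-- The elements of `FOUR`. Truth order: `f < bot, top < t`, with `bot, top` incomparable.
Knowledge order: `bot < f, t < top`, with `f, t` incomparable. -/
inductive Four : Type u
  | bot
  | f
  | t
  | top

/-- Truth meet. -/
def Four.tand : Four.{u} → Four.{u} → Four.{u}
  | .t, y => y
  | x, .t => x
  | .bot, .bot => .bot
  | .top, .top => .top
  | _, _ => .f

/-- Truth join. -/
def Four.tor : Four.{u} → Four.{u} → Four.{u}
  | .f, y => y
  | x, .f => x
  | .bot, .bot => .bot
  | .top, .top => .top
  | _, _ => .t

/-- Knowledge meet. -/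
def Four.kand : Four.{u} → Four.{u} → Four.{u}
  | .top, y => y
  | x, .top => x
  | .f, .f => .f
  | .t, .t => .t
  | _, _ => .bot

/-- Knowledge join. -/
def Four.kor : Four.{u} → Four.{u} → Four.{u}
  | .bot, y => y
  | x, .bot => x
  | .f, .f => .f
  | .t, .t => .t
  | _, _ => .top

/-- Negation exchanges `t` and `f` and fixes `bot` and `top`. -/
def Four.neg : Four.{u} → Four.{u}
  | .f => .t
  | .t => .f
  | .bot => .bot
  | .top => .top

instance instOpsFour : Ops Four.{u} where
  op
    | .tand => Four.tand
    | .tor => Four.tor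
    | .kand => Four.kand
    | .kor => Four.kor
  neg := Four.neg

/-- The algebra `FOUR`. -/
def FOUR : Alg.{u} where
  carrier := Four.{u}
  nonempty := ⟨Four.bot⟩

/-- The designated elements. -/
def Tr : Set Four.{u} := {Four.t, Four.top}

/-! ### Varieties -/

/-- A variety: a nonempty class of algebras that is closed under homomorphic images, (isomorphic
copies of) subalgebras and direct products. -/
structure IsVariety (K : Set Alg.{u}) : Prop where
  nonempty : K.Nonempty
  image : ∀ (A B : Alg.{u}) (h : A.carrier → B.carrier),
    IsHom h → Function.Surjective h → A ∈ K → B ∈ K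
  sub : ∀ (A B : Alg.{u}) (h : A.carrier → B.carrier),
    IsHom h → Function.Injective h → B ∈ K → A ∈ K
  prod : ∀ (I : Type u) (A : I → Alg.{u}), (∀ i, A i ∈ K) → Alg.prod A ∈ K

/-- The variety generated by a class `X`: the smallest variety that contains `X`. -/
def varietyGenerated (X : Set Alg.{u}) : Set Alg.{u} := ⋂₀ {K | IsVariety K ∧ X ⊆ K}

/-! ### The logic `LB` -/

/-- Formulas, over countably many variables. -/
inductive Fm : Type
  | var : ℕ → Fm
  | op : Conn → Fm → Fm → Fm
  | neg : Fm → Fm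

/-- The formula algebra. -/
instance instOpsFm : Ops Fm where
  op := Fm.op
  neg := Fm.neg

/-- The consequence relation defined by the matrix `⟨A, D⟩`. -/
def MatrixEntails {A : Type u} [Ops A] (D : Set A) (Γ : Set Fm) (φ : Fm) : Prop :=
  ∀ h : Fm → A, IsHom h → h '' Γ ⊆ D → h φ ∈ D

/-- The consequence relation of `LB`, the logic defined by the matrix `⟨FOUR, Tr⟩`. -/
def LBEntails (Γ : Set Fm) (φ : Fm) : Prop := MatrixEntails Tr.{0} Γ φ

/-- `F` is an `LB`-filter on `A`, i.e. the matrix `⟨A, F⟩` is a model of `LB`. -/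
def IsLBFilter {A : Type u} [Ops A] (F : Set A) : Prop :=
  ∀ (Γ : Set Fm) (φ : Fm), LBEntails Γ φ → MatrixEntails F Γ φ

/-! ### Reduced matrices and reduced generalized matrices -/

/-- The equivalence relation `θ` is compatible with the set `F`. -/
def Compatible {A : Type u} (θ : Setoid A) (F : Set A) : Prop :=
  ∀ a b : A, a ∈ F → θ a b → b ∈ F

/-- `θ` is the Leibniz congruence of the matrix `⟨A, F⟩`: the greatest congruence that is
compatible with `F`. -/
def IsLeibnizCongruence {A : Type u} [Ops A] (F : Set A) (θ : Setoid A) : Prop :=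
  IsGreatest {η : Setoid A | IsCongruence η ∧ Compatible η F} θ

/-- `θ` is the Tarski congruence of the generalized matrix `⟨A, C⟩`: the greatest congruence that
is compatible with all members of `C`. -/
def IsTarskiCongruence {A : Type u} [Ops A] (C : Set (Set A)) (θ : Setoid A) : Prop :=
  IsGreatest {η : Setoid A | IsCongruence η ∧ ∀ F ∈ C, Compatible η F} θ

/-- A closure system on `A`: a family of subsets closed under arbitrary intersections
(the empty intersection being `A`). -/
def IsClosureSystem {A : Type u} (C : Set (Set A)) : Prop :=
  ∀ S : Set (Set A), S ⊆ C → ⋂₀ S ∈ C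

/-- The class of algebraic reducts of reduced (matrix) models of `LB`. In the lattice of
equivalence relations, `⊥` is the identity relation. -/
def AlgStarLB : Set Alg.{u} :=
  {A | ∃ F : Set A.carrier, IsLBFilter F ∧ IsLeibnizCongruence F (⊥ : Setoid A.carrier)}

/-- The class of algebraic reducts of reduced generalized models of `LB`. -/
def AlgLB : Set Alg.{u} :=
  {A | ∃ C : Set (Set A.carrier), IsClosureSystem C ∧ (∀ F ∈ C, IsLBFilter F) ∧
    IsTarskiCongruence C (⊥ : Setoid A.carrier)}

end Bilat

namespace Bilat

/-! An element of `FOUR` is determined by two bits: whether it and its negation are designated.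
Hence homomorphisms into `FOUR` correspond to prime bifilters, and identities of `FOUR` reduce to
propositional logic.

The equalities pass through `EqFour`, the class of models of the equations of `FOUR`, which is
contained in `DBiLat`. It contains the generated variety, and also `AlgLB`: inseparability in all
disjunctions by the filters of `C`, for elements and for their negations, is a congruence that
identifies both sides of every such equation (`joinEquiv_eval`, `isCongruence_joinSetoid`), so it
lies below the Tarski congruence.

Both cycles close by separation (`exists_isPrimeBifilter`). In a distributive bilattice a prime
filter of the truth lattice is an up-set or a down-set for the knowledge order; it is a prime
bifilter in the first case and is turned into one by negation and complement in the second. Prime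
bifilters therefore separate points, which embeds the algebra in a power of `FOUR` and makes its
Tarski congruence for all `LB`-filters trivial.

For strictness, each `LB`-filter on the algebra of increasing pairs is compatible with the kernel of
one of the two projections, and neither kernel is the identity. -/

/-! ### Evaluation of formulas -/

/-- The value of a formula under a valuation. -/
def Fm.eval {A : Type u} [Ops A] (v : ℕ → A) : Fm → A
  | .var n => v n
  | .op c φ ψ => Ops.op c (φ.eval v) (ψ.eval v)
  | .neg φ => Ops.neg (φ.eval v)

theorem isHom_eval {A : Type u} [Ops A] (v : ℕ → A) : IsHom (Fm.eval v) :=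
  ⟨fun _ _ _ => rfl, fun _ => rfl⟩

theorem IsHom.eval {A : Type u} {B : Type v} [Ops A] [Ops B] {h : A → B} (hh : IsHom h)
    (w : ℕ → A) (φ : Fm) : h (φ.eval w) = φ.eval (h ∘ w) := by
  induction φ with
  | var n => rfl
  | op c φ ψ ih₁ ih₂ => simp only [Fm.eval, hh.map_op, ih₁, ih₂]
  | neg φ ih => simp only [Fm.eval, hh.map_neg, ih]

theorem IsHom.eq_eval {A : Type u} [Ops A] {h : Fm → A} (hh : IsHom h) (φ : Fm) :
    h φ = φ.eval (h ∘ Fm.var) := by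
  have hid : ∀ ψ : Fm, ψ.eval Fm.var = ψ := by
    intro ψ
    induction ψ with
    | var n => rfl
    | op c φ ψ ih₁ ih₂ => simp only [Fm.eval, ih₁, ih₂]; rfl
    | neg φ ih => simp only [Fm.eval, ih]; rfl
  rw [← hh.eval, hid]

theorem eval_pi {I : Type v} (A : I → Type u) [∀ i, Ops (A i)] (v : ℕ → ∀ i, A i) (φ : Fm)
    (i : I) : φ.eval v i = φ.eval (fun n => v n i) :=
  IsHom.eval (h := fun x : ∀ i, A i => x i) ⟨fun _ _ _ => rfl, fun _ => rfl⟩ v φ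

/-! ### Prime bifilters and homomorphisms to `FOUR` -/

/-- Subsets whose membership, together with that of negations, behaves as in `FOUR`. -/
structure IsPrimeBifilter {A : Type u} [Ops A] (P : Set A) : Prop where
  tand : ∀ a b, Ops.op .tand a b ∈ P ↔ a ∈ P ∧ b ∈ P
  tor : ∀ a b, Ops.op .tor a b ∈ P ↔ a ∈ P ∨ b ∈ P
  kand : ∀ a b, Ops.op .kand a b ∈ P ↔ a ∈ P ∧ b ∈ P
  kor : ∀ a b, Ops.op .kor a b ∈ P ↔ a ∈ P ∨ b ∈ P
  neg_tand : ∀ a b, Ops.neg (Ops.op .tand a b) ∈ P ↔ Ops.neg a ∈ P ∨ Ops.neg b ∈ P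
  neg_tor : ∀ a b, Ops.neg (Ops.op .tor a b) ∈ P ↔ Ops.neg a ∈ P ∧ Ops.neg b ∈ P
  neg_kand : ∀ a b, Ops.neg (Ops.op .kand a b) ∈ P ↔ Ops.neg a ∈ P ∧ Ops.neg b ∈ P
  neg_kor : ∀ a b, Ops.neg (Ops.op .kor a b) ∈ P ↔ Ops.neg a ∈ P ∨ Ops.neg b ∈ P
  neg_neg : ∀ a, Ops.neg (Ops.neg a) ∈ P ↔ a ∈ P

theorem isPrimeBifilter_Tr : IsPrimeBifilter Tr.{u} := by
  constructor <;> intro a <;> try intro b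
  all_goals cases a <;> try cases b
  all_goals simp [Ops.op, Ops.neg, Four.tand, Four.tor, Four.kand, Four.kor, Four.neg, Tr]

theorem Four.ext_Tr {a b : Four.{u}} (h₁ : a ∈ Tr ↔ b ∈ Tr)
    (h₂ : Ops.neg a ∈ Tr ↔ Ops.neg b ∈ Tr) : a = b := by
  cases a <;> cases b <;> simp_all [Ops.neg, Four.neg, Tr]

open Classical in
/-- The map to `FOUR` that records membership in `P` of an element and of its negation. -/
noncomputable def charMap {A : Type u} [Ops A] (P : Set A) (a : A) : Four.{v} :=
  if a ∈ P then (if Ops.neg a ∈ P then .top else .t) else (if Ops.neg a ∈ P then .f else .bot)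

theorem charMap_mem_Tr {A : Type u} [Ops A] (P : Set A) (a : A) :
    charMap.{u, v} P a ∈ Tr ↔ a ∈ P := by
  unfold charMap
  split_ifs <;> simp_all [Tr]

theorem neg_charMap_mem_Tr {A : Type u} [Ops A] (P : Set A) (a : A) :
    Ops.neg (charMap.{u, v} P a) ∈ Tr ↔ Ops.neg a ∈ P := by
  unfold charMap
  split_ifs <;> simp_all [Tr, Ops.neg, Four.neg]

theorem IsPrimeBifilter.isHom_charMap {A : Type u} [Ops A] {P : Set A} (hP : IsPrimeBifilter P) :
    IsHom (charMap.{u, v} P) := by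
  have hT := isPrimeBifilter_Tr.{v}
  constructor
  · intro c a b
    cases c <;> apply Four.ext_Tr <;>
      simp only [charMap_mem_Tr, neg_charMap_mem_Tr, hP.tand, hP.tor, hP.kand, hP.kor,
        hP.neg_tand, hP.neg_tor, hP.neg_kand, hP.neg_kor, hT.tand, hT.tor, hT.kand, hT.kor,
        hT.neg_tand, hT.neg_tor, hT.neg_kand, hT.neg_kor]
  · intro a
    apply Four.ext_Tr <;>
      simp only [charMap_mem_Tr, neg_charMap_mem_Tr, hP.neg_neg, hT.neg_neg]

/-- `P` is the preimage of `Tr` under the homomorphism `charMap P`. -/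
theorem IsPrimeBifilter.isLBFilter {A : Type u} [Ops A] {P : Set A} (hP : IsPrimeBifilter P) :
    IsLBFilter P := by
  intro Γ φ hΓ h hh hF
  rw [← charMap_mem_Tr.{u, 0}]
  refine hΓ (fun ψ => charMap P (h ψ)) ⟨fun c x y => ?_, fun x => ?_⟩ ?_
  · simp only [hh.map_op, hP.isHom_charMap.map_op]
  · simp only [hh.map_neg, hP.isHom_charMap.map_neg]
  · rintro _ ⟨ψ, hψ, rfl⟩
    exact (charMap_mem_Tr P _).2 (hF ⟨ψ, hψ, rfl⟩)

/-! ### The equational theory of `FOUR` -/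

/-- The algebras that satisfy every equation valid in `FOUR`. -/
def EqFour : Set Alg.{u} :=
  {A | ∀ φ ψ : Fm, (∀ w : ℕ → Four.{0}, φ.eval w = ψ.eval w) →
    ∀ v : ℕ → A.carrier, φ.eval v = ψ.eval v}

/-- Universe transfer: `charMap Tr` is an injective homomorphism between the two copies of `FOUR`.
-/
theorem Four.eval_eq_of_eval_eq {φ ψ : Fm} (h : ∀ w : ℕ → Four.{0}, φ.eval w = ψ.eval w)
    (v : ℕ → Four.{u}) : φ.eval v = ψ.eval v := by
  have hh := isPrimeBifilter_Tr.{u}.isHom_charMap.{u, 0}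
  have key : charMap.{u, 0} Tr.{u} (φ.eval v) = charMap.{u, 0} Tr.{u} (ψ.eval v) := by
    rw [hh.eval, hh.eval, h]
  apply Four.ext_Tr
  · rw [← charMap_mem_Tr.{u, 0}, key, charMap_mem_Tr]
  · rw [← neg_charMap_mem_Tr.{u, 0}, key, neg_charMap_mem_Tr]

theorem FOUR_mem_EqFour : FOUR.{u} ∈ EqFour :=
  fun _ _ h v => Four.eval_eq_of_eval_eq h v

theorem isVariety_EqFour : IsVariety EqFour.{u} where
  nonempty := ⟨FOUR, FOUR_mem_EqFour⟩
  image A B h hh hs hA φ ψ he v := by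
    choose g hg using hs
    have hv : v = h ∘ (g ∘ v) := by
      funext n
      exact (hg (v n)).symm
    rw [hv, ← hh.eval, ← hh.eval, hA φ ψ he]
  sub A B h hh hi hB φ ψ he v := by
    apply hi
    rw [hh.eval, hh.eval, hB φ ψ he]
  prod I A hA φ ψ he v := by
    funext i
    exact (eval_pi _ v φ i).trans ((hA i φ ψ he _).trans (eval_pi _ v ψ i).symm)

theorem varietyGenerated_subset_EqFour : varietyGenerated {FOUR.{u}} ⊆ EqFour :=
  Set.sInter_subset_of_mem
    ⟨isVariety_EqFour, Set.singleton_subset_iff.2 FOUR_mem_EqFour⟩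

/-- The valuation sending the first variables to `a`, `b` and all others to `c`. -/
def valuation {A : Type u} (a b c : A) : ℕ → A
  | 0 => a
  | 1 => b
  | _ => c

theorem EqFour_subset_DBiLat : EqFour.{u} ⊆ DBiLat := by
  intro A hA
  have hT := isPrimeBifilter_Tr.{0}
  have eqn (φ ψ : Fm) (h : ∀ w : ℕ → Four.{0}, φ.eval w = ψ.eval w) (a b c : A.carrier) :
      φ.eval (valuation a b c) = ψ.eval (valuation a b c) := hA φ ψ h _
  have comm (c : Conn) (x y : A.carrier) : Ops.op c x y = Ops.op c y x :=
    eqn (.op c (.var 0) (.var 1)) (.op c (.var 1) (.var 0)) (by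
      intro w
      cases c <;> apply Four.ext_Tr <;>
        simp only [Fm.eval, hT.tand, hT.tor, hT.kand, hT.kor,
          hT.neg_tand, hT.neg_tor, hT.neg_kand, hT.neg_kor] <;> grind) x y y
  have assoc (c : Conn) (x y z : A.carrier) :
      Ops.op c (Ops.op c x y) z = Ops.op c x (Ops.op c y z) :=
    eqn (.op c (.op c (.var 0) (.var 1)) (.var 2)) (.op c (.var 0) (.op c (.var 1) (.var 2))) (by
      intro w
      cases c <;> apply Four.ext_Tr <;>
        simp only [Fm.eval, hT.tand, hT.tor, hT.kand, hT.kor,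
          hT.neg_tand, hT.neg_tor, hT.neg_kand, hT.neg_kor] <;> grind) x y z
  have absorb (c d : Conn) (hcd : (c = .tand ∧ d = .tor) ∨ (c = .tor ∧ d = .tand) ∨
      (c = .kand ∧ d = .kor) ∨ (c = .kor ∧ d = .kand)) (x y : A.carrier) :
      Ops.op c x (Ops.op d x y) = x :=
    eqn (.op c (.var 0) (.op d (.var 0) (.var 1))) (.var 0) (by
      intro w
      rcases hcd with ⟨rfl, rfl⟩ | ⟨rfl, rfl⟩ | ⟨rfl, rfl⟩ | ⟨rfl, rfl⟩ <;>
        apply Four.ext_Tr <;>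
        simp only [Fm.eval, hT.tand, hT.tor, hT.kand, hT.kor,
          hT.neg_tand, hT.neg_tor, hT.neg_kand, hT.neg_kor] <;> grind) x y y
  have neg_tand (x y : A.carrier) :
      Ops.neg (Ops.op .tand x y) = Ops.op .tor (Ops.neg x) (Ops.neg y) :=
    eqn (.neg (.op .tand (.var 0) (.var 1))) (.op .tor (.neg (.var 0)) (.neg (.var 1))) (by
      intro w
      apply Four.ext_Tr <;>
        simp only [Fm.eval, hT.tand, hT.tor, hT.neg_tand, hT.neg_tor, hT.neg_neg]) x y y
  have neg_kand (x y : A.carrier) :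
      Ops.neg (Ops.op .kand x y) = Ops.op .kand (Ops.neg x) (Ops.neg y) :=
    eqn (.neg (.op .kand (.var 0) (.var 1))) (.op .kand (.neg (.var 0)) (.neg (.var 1))) (by
      intro w
      apply Four.ext_Tr <;>
        simp only [Fm.eval, hT.kand, hT.neg_kand, hT.neg_neg]) x y y
  refine ⟨⟨⟨comm _, comm _, assoc _, assoc _, absorb _ _ (by simp), absorb _ _ (by simp)⟩,
    ⟨comm _, comm _, assoc _, assoc _, absorb _ _ (by simp), absorb _ _ (by simp)⟩, ?_, ?_, ?_⟩, ?_⟩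
  · intro a b h
    unfold LeT at h ⊢
    rw [← h, neg_tand, comm .tor, absorb _ _ (by simp)]
  · intro a b h
    unfold LeK at h ⊢
    rw [← neg_kand, h]
  · intro a
    exact eqn (.neg (.neg (.var 0))) (.var 0) (by
      intro w
      apply Four.ext_Tr <;> simp only [Fm.eval, hT.neg_neg]) a a a
  · intro c d hcd x y z
    exact eqn (.op c (.var 0) (.op d (.var 1) (.var 2)))
      (.op d (.op c (.var 0) (.var 1)) (.op c (.var 0) (.var 2))) (by
      intro w
      cases c <;> cases d <;> first | exact absurd rfl hcd | skip
      all_goals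
        apply Four.ext_Tr <;>
        simp only [Fm.eval, hT.tand, hT.tor, hT.kand, hT.kor,
          hT.neg_tand, hT.neg_tor, hT.neg_kand, hT.neg_kor] <;> grind) x y z

/-! ### `LB`-filters -/

theorem IsLBFilter.eval_mem {A : Type u} [Ops A] {F : Set A} (hF : IsLBFilter F) (Γ : Set Fm)
    (φ : Fm) (h : ∀ w : ℕ → Four.{0}, (∀ γ ∈ Γ, γ.eval w ∈ Tr) → φ.eval w ∈ Tr) (v : ℕ → A)
    (hΓ : ∀ γ ∈ Γ, γ.eval v ∈ F) : φ.eval v ∈ F := by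
  refine hF Γ φ ?_ _ (isHom_eval v) ?_
  · intro g hg hT
    rw [hg.eq_eval]
    refine h _ fun γ hγ => ?_
    rw [← hg.eq_eval]
    exact hT ⟨γ, hγ, rfl⟩
  · rintro _ ⟨γ, hγ, rfl⟩
    exact hΓ γ hγ

theorem IsLBFilter.eval_mem_congr {A : Type u} [Ops A] {F : Set A} (hF : IsLBFilter F) (φ ψ : Fm)
    (h : ∀ w : ℕ → Four.{0}, φ.eval w ∈ Tr ↔ ψ.eval w ∈ Tr) (v : ℕ → A) :
    φ.eval v ∈ F ↔ ψ.eval v ∈ F := by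
  constructor <;> intro hm
  · exact hF.eval_mem {φ} ψ (fun w hw => (h w).1 (hw φ rfl)) v (by simpa using hm)
  · exact hF.eval_mem {ψ} φ (fun w hw => (h w).2 (hw ψ rfl)) v (by simpa using hm)

theorem IsLBFilter.tand_mem {A : Type u} [Ops A] {F : Set A} (hF : IsLBFilter F) (a b : A) :
    Ops.op .tand a b ∈ F ↔ a ∈ F ∧ b ∈ F := by
  have hT := isPrimeBifilter_Tr.{0}
  refine ⟨fun h => ⟨?_, ?_⟩, fun h => ?_⟩
  · exact hF.eval_mem {.op .tand (.var 0) (.var 1)} (.var 0)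
      (by simp only [Set.mem_singleton_iff, forall_eq, Fm.eval, hT.tand]; grind)
      (valuation a b b) (by simpa [Fm.eval, valuation] using h)
  · exact hF.eval_mem {.op .tand (.var 0) (.var 1)} (.var 1)
      (by simp only [Set.mem_singleton_iff, forall_eq, Fm.eval, hT.tand]; grind)
      (valuation a b b) (by simpa [Fm.eval, valuation] using h)
  · exact hF.eval_mem {.var 0, .var 1} (.op .tand (.var 0) (.var 1))
      (by simp only [Set.mem_insert_iff, Set.mem_singleton_iff, forall_eq_or_imp, forall_eq,
            Fm.eval, hT.tand]; grind)
      (valuation a b b) (by simpa [Fm.eval, valuation] using h)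

theorem IsLBFilter.tor_mem_left {A : Type u} [Ops A] {F : Set A} (hF : IsLBFilter F) {a : A}
    (ha : a ∈ F) (b : A) : Ops.op .tor a b ∈ F := by
  have hT := isPrimeBifilter_Tr.{0}
  exact hF.eval_mem {.var 0} (.op .tor (.var 0) (.var 1))
    (by simp only [Set.mem_singleton_iff, forall_eq, Fm.eval, hT.tor]; grind)
    (valuation a b b) (by simpa [Fm.eval, valuation] using ha)

theorem IsLBFilter.kor_mem_left {A : Type u} [Ops A] {F : Set A} (hF : IsLBFilter F) {a : A}
    (ha : a ∈ F) (b : A) : Ops.op .kor a b ∈ F := by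
  have hT := isPrimeBifilter_Tr.{0}
  exact hF.eval_mem {.var 0} (.op .kor (.var 0) (.var 1))
    (by simp only [Set.mem_singleton_iff, forall_eq, Fm.eval, hT.kor]; grind)
    (valuation a b b) (by simpa [Fm.eval, valuation] using ha)

/-- No lattice law is available in `A`; idempotence survives only as far as `F` can see. -/
theorem IsLBFilter.tor_self_mem {A : Type u} [Ops A] {F : Set A} (hF : IsLBFilter F) (a : A) :
    Ops.op .tor a a ∈ F ↔ a ∈ F := by
  have hT := isPrimeBifilter_Tr.{0}
  exact hF.eval_mem_congr (.op .tor (.var 0) (.var 0)) (.var 0)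
    (by simp only [Fm.eval, hT.tor]; grind) (valuation a a a)

theorem isLBFilter_univ {A : Type u} [Ops A] : IsLBFilter (Set.univ : Set A) :=
  fun _ _ _ _ _ _ => Set.mem_univ _

theorem IsLBFilter.sInter {A : Type u} [Ops A] {S : Set (Set A)} (hS : ∀ F ∈ S, IsLBFilter F) :
    IsLBFilter (⋂₀ S) :=
  fun Γ φ hΓ h hh hm F hF => hS F hF Γ φ hΓ h hh fun _ hx => hm hx F hF

/-! ### A congruence compatible with a family of `LB`-filters -/

/-- Two elements are related if no member of `C` separates them in a disjunction. -/
def JoinEquiv {A : Type u} [Ops A] (C : Set (Set A)) (a b : A) : Prop :=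
  ∀ F ∈ C, ∀ c, Ops.op .tor a c ∈ F ↔ Ops.op .tor b c ∈ F

theorem JoinEquiv.symm {A : Type u} [Ops A] {C : Set (Set A)} {a b : A} (h : JoinEquiv C a b) :
    JoinEquiv C b a := fun F hF c => (h F hF c).symm

theorem JoinEquiv.trans {A : Type u} [Ops A] {C : Set (Set A)} {a b c : A}
    (h : JoinEquiv C a b) (h' : JoinEquiv C b c) : JoinEquiv C a c :=
  fun F hF d => (h F hF d).trans (h' F hF d)

theorem joinEquiv_eval {A : Type u} [Ops A] {C : Set (Set A)} (hC : ∀ F ∈ C, IsLBFilter F)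
    (φ ψ : Fm) (h : ∀ w : ℕ → Four.{0}, φ.eval w ∈ Tr ↔ ψ.eval w ∈ Tr) (v : ℕ → A) :
    JoinEquiv C (φ.eval v) (ψ.eval v) := by
  intro F hF c
  have hT := isPrimeBifilter_Tr.{0}
  -- Shifting all variables by one frees variable `0` to stand for the side element `c`.
  have hshift (B : Type u) [Ops B] (w : ℕ → B) (χ : Fm) :
      (χ.eval fun n => Fm.var (n + 1)).eval w = χ.eval fun n => w (n + 1) :=
    (isHom_eval w).eval _ χ
  have hshift₀ (w : ℕ → Four.{0}) (χ : Fm) :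
      (χ.eval fun n => Fm.var (n + 1)).eval w = χ.eval fun n => w (n + 1) :=
    (isHom_eval w).eval _ χ
  have key := (hC F hF).eval_mem_congr
    (.op .tor (φ.eval fun n => Fm.var (n + 1)) (.var 0))
    (.op .tor (ψ.eval fun n => Fm.var (n + 1)) (.var 0))
    (fun w => by simp only [Fm.eval, hT.tor, hshift₀, h]) (fun n => Nat.casesOn n c v)
  simp only [Fm.eval, hshift] at key
  exact key

theorem JoinEquiv.tand {A : Type u} [Ops A] {C : Set (Set A)} (hC : ∀ F ∈ C, IsLBFilter F)
    {a a' b b' : A} (ha : JoinEquiv C a a') (hb : JoinEquiv C b b') :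
    JoinEquiv C (Ops.op .tand a b) (Ops.op .tand a' b') := by
  intro F hF c
  have hT := isPrimeBifilter_Tr.{0}
  have key (x y : A) : Ops.op .tor (Ops.op .tand x y) c ∈ F ↔
      Ops.op .tor x c ∈ F ∧ Ops.op .tor y c ∈ F := by
    rw [← (hC F hF).tand_mem]
    exact (hC F hF).eval_mem_congr (.op .tor (.op .tand (.var 0) (.var 1)) (.var 2))
      (.op .tand (.op .tor (.var 0) (.var 2)) (.op .tor (.var 1) (.var 2)))
      (by simp only [Fm.eval, hT.tor, hT.tand]; grind) (valuation x y c)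
  rw [key, key, ha F hF, hb F hF]

theorem JoinEquiv.tor {A : Type u} [Ops A] {C : Set (Set A)} (hC : ∀ F ∈ C, IsLBFilter F)
    {a a' b b' : A} (ha : JoinEquiv C a a') (hb : JoinEquiv C b b') :
    JoinEquiv C (Ops.op .tor a b) (Ops.op .tor a' b') := by
  intro F hF c
  have hT := isPrimeBifilter_Tr.{0}
  have assoc (x y : A) : Ops.op .tor (Ops.op .tor x y) c ∈ F ↔
      Ops.op .tor x (Ops.op .tor y c) ∈ F :=
    (hC F hF).eval_mem_congr (.op .tor (.op .tor (.var 0) (.var 1)) (.var 2))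
      (.op .tor (.var 0) (.op .tor (.var 1) (.var 2)))
      (by simp only [Fm.eval, hT.tor]; grind) (valuation x y c)
  have swap (x y : A) : Ops.op .tor x (Ops.op .tor y c) ∈ F ↔
      Ops.op .tor y (Ops.op .tor x c) ∈ F :=
    (hC F hF).eval_mem_congr (.op .tor (.var 0) (.op .tor (.var 1) (.var 2)))
      (.op .tor (.var 1) (.op .tor (.var 0) (.var 2)))
      (by simp only [Fm.eval, hT.tor]; grind) (valuation x y c)
  rw [assoc, ha F hF, swap, hb F hF, swap, ← assoc]

/-- The equivalence relation that relates `a` and `b` if they, and their negations, are not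
separated in disjunctions by `C`. -/
def joinSetoid {A : Type u} [Ops A] (C : Set (Set A)) : Setoid A where
  r a b := JoinEquiv C a b ∧ JoinEquiv C (Ops.neg a) (Ops.neg b)
  iseqv := ⟨fun _ => ⟨fun _ _ _ => Iff.rfl, fun _ _ _ => Iff.rfl⟩,
    fun h => ⟨h.1.symm, h.2.symm⟩, fun h h' => ⟨h.1.trans h'.1, h.2.trans h'.2⟩⟩

/-- Up to `JoinEquiv`, `⊗` agrees with `∧`, `⊕` agrees with `∨`, and negation obeys De Morgan laws,
so everything reduces to `JoinEquiv.tand` and `JoinEquiv.tor`. -/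
theorem isCongruence_joinSetoid {A : Type u} [Ops A] {C : Set (Set A)}
    (hC : ∀ F ∈ C, IsLBFilter F) : IsCongruence (joinSetoid C) := by
  have hT := isPrimeBifilter_Tr.{0}
  have kand (x y : A) : JoinEquiv C (Ops.op .kand x y) (Ops.op .tand x y) :=
    joinEquiv_eval hC (.op .kand (.var 0) (.var 1)) (.op .tand (.var 0) (.var 1))
      (by simp only [Fm.eval, hT.tand, hT.kand, implies_true]) (valuation x y y)
  have kor (x y : A) : JoinEquiv C (Ops.op .kor x y) (Ops.op .tor x y) :=
    joinEquiv_eval hC (.op .kor (.var 0) (.var 1)) (.op .tor (.var 0) (.var 1))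
      (by simp only [Fm.eval, hT.tor, hT.kor, implies_true]) (valuation x y y)
  have ntand (x y : A) : JoinEquiv C (Ops.neg (Ops.op .tand x y))
      (Ops.op .tor (Ops.neg x) (Ops.neg y)) :=
    joinEquiv_eval hC (.neg (.op .tand (.var 0) (.var 1)))
      (.op .tor (.neg (.var 0)) (.neg (.var 1)))
      (by simp only [Fm.eval, hT.tor, hT.neg_tand, implies_true]) (valuation x y y)
  have ntor (x y : A) : JoinEquiv C (Ops.neg (Ops.op .tor x y))
      (Ops.op .tand (Ops.neg x) (Ops.neg y)) :=
    joinEquiv_eval hC (.neg (.op .tor (.var 0) (.var 1)))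
      (.op .tand (.neg (.var 0)) (.neg (.var 1)))
      (by simp only [Fm.eval, hT.tand, hT.neg_tor, implies_true]) (valuation x y y)
  have nkand (x y : A) : JoinEquiv C (Ops.neg (Ops.op .kand x y))
      (Ops.op .tand (Ops.neg x) (Ops.neg y)) :=
    joinEquiv_eval hC (.neg (.op .kand (.var 0) (.var 1)))
      (.op .tand (.neg (.var 0)) (.neg (.var 1)))
      (by simp only [Fm.eval, hT.tand, hT.neg_kand, implies_true]) (valuation x y y)
  have nkor (x y : A) : JoinEquiv C (Ops.neg (Ops.op .kor x y))
      (Ops.op .tor (Ops.neg x) (Ops.neg y)) :=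
    joinEquiv_eval hC (.neg (.op .kor (.var 0) (.var 1)))
      (.op .tor (.neg (.var 0)) (.neg (.var 1)))
      (by simp only [Fm.eval, hT.tor, hT.neg_kor, implies_true]) (valuation x y y)
  have nn (x : A) : JoinEquiv C (Ops.neg (Ops.neg x)) x :=
    joinEquiv_eval hC (.neg (.neg (.var 0))) (.var 0)
      (by simp only [Fm.eval, hT.neg_neg, implies_true]) (valuation x x x)
  constructor
  · rintro c x x' y y' ⟨hx, hnx⟩ ⟨hy, hny⟩
    cases c
    · exact ⟨hx.tand hC hy, (ntand x y).trans ((hnx.tor hC hny).trans (ntand x' y').symm)⟩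
    · exact ⟨hx.tor hC hy, (ntor x y).trans ((hnx.tand hC hny).trans (ntor x' y').symm)⟩
    · exact ⟨(kand x y).trans ((hx.tand hC hy).trans (kand x' y').symm),
        (nkand x y).trans ((hnx.tand hC hny).trans (nkand x' y').symm)⟩
    · exact ⟨(kor x y).trans ((hx.tor hC hy).trans (kor x' y').symm),
        (nkor x y).trans ((hnx.tor hC hny).trans (nkor x' y').symm)⟩
  · rintro x x' ⟨hx, hnx⟩
    exact ⟨hnx, (nn x).trans (hx.trans (nn x').symm)⟩

theorem compatible_joinSetoid {A : Type u} [Ops A] {C : Set (Set A)}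
    (hC : ∀ F ∈ C, IsLBFilter F) {F : Set A} (hF : F ∈ C) : Compatible (joinSetoid C) F :=
  fun _ b ha hab => ((hC F hF).tor_self_mem b).1
    ((hab.1 F hF b).1 ((hC F hF).tor_mem_left ha b))

theorem AlgLB_subset_EqFour : AlgLB.{u} ⊆ EqFour := by
  rintro A ⟨C, -, hC, hT⟩ φ ψ h v
  have hle : joinSetoid C ≤ ⊥ :=
    hT.2 ⟨isCongruence_joinSetoid hC, fun F hF => compatible_joinSetoid hC hF⟩
  refine hle (x := φ.eval v) (y := ψ.eval v) ⟨?_, ?_⟩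
  · exact joinEquiv_eval hC φ ψ (fun w => by rw [h]) v
  · exact joinEquiv_eval hC (.neg φ) (.neg ψ) (fun w => by simp only [Fm.eval, h]) v

/-! ### Lattices presented as algebras -/

/-- The lattice given by the operations. -/
@[reducible]
def IsLatticeAlg.toLattice {A : Type u} {meet join : A → A → A} (h : IsLatticeAlg meet join) :
    Lattice A :=
  letI : Max A := ⟨join⟩
  letI : Min A := ⟨meet⟩
  Lattice.mk' h.join_comm h.join_assoc h.meet_comm h.meet_assoc h.join_meet h.meet_join

theorem IsLatticeAlg.meet_self {A : Type u} {meet join : A → A → A} (h : IsLatticeAlg meet join) (x : A) :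
    meet x x = x := by
  have := h.meet_join x (meet x x)
  rwa [h.join_meet] at this

theorem IsLatticeAlg.join_self {A : Type u} {meet join : A → A → A} (h : IsLatticeAlg meet join) (x : A) :
    join x x = x := by
  have := h.join_meet x (join x x)
  rwa [h.meet_join] at this

theorem IsLatticeAlg.exists_prime_filter {A : Type u} {meet join : A → A → A}
    (h : IsLatticeAlg meet join)
    (hd : ∀ x y z, meet x (join y z) = join (meet x y) (meet x z)) {a b : A}
    (hab : meet a b ≠ a) :
    ∃ P : Set A, (∀ x y, meet x y ∈ P ↔ x ∈ P ∧ y ∈ P) ∧ (∀ x y, join x y ∈ P ↔ x ∈ P ∨ y ∈ P) ∧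
      a ∈ P ∧ b ∉ P := by
  let _ : Lattice A := h.toLattice
  let _ : DistribLattice A := DistribLattice.ofInfSupLe fun x y z => (hd x y z).le
  have hle : ¬ a ≤ b := fun hle => hab (inf_eq_left.2 hle)
  obtain ⟨J, hJ, hbJ, haJ⟩ := DistribLattice.prime_ideal_of_disjoint_filter_ideal
    (F := Order.PFilter.principal a) (I := Order.Ideal.principal b) (by
      rw [Set.disjoint_left]
      intro x hx hx'
      exact hle (le_trans (Order.PFilter.mem_principal.1 hx) (Order.Ideal.mem_principal.1 hx')))
  refine ⟨{x | x ∉ J}, fun x y => ?_, fun x y => ?_, ?_, ?_⟩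
  · have h₁ : x ⊓ y ∈ J ↔ x ∈ J ∨ y ∈ J :=
      ⟨hJ.mem_or_mem, fun h => h.elim (J.lower inf_le_left) (J.lower inf_le_right)⟩
    exact (not_congr h₁).trans not_or
  · have h₁ : x ⊔ y ∈ J ↔ x ∈ J ∧ y ∈ J := Order.Ideal.sup_mem_iff
    exact (not_congr h₁).trans not_and_or
  · exact Set.disjoint_left.1 haJ (Order.PFilter.mem_principal.2 le_rfl)
  · exact not_not.2 (hbJ (Order.Ideal.mem_principal.2 le_rfl))

theorem IsLatticeAlg.map_meet_of_antitone {A : Type u} {meet join : A → A → A}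
    (h : IsLatticeAlg meet join) {n : A → A} (hn : ∀ a, n (n a) = a)
    (ha : ∀ a b, meet a b = a → meet (n b) (n a) = n b) (x y : A) :
    n (meet x y) = join (n x) (n y) ∧ n (join x y) = meet (n x) (n y) := by
  let _ : Lattice A := h.toLattice
  have hanti (a b : A) (hab : a ≤ b) : n b ≤ n a := inf_eq_left.1 (ha a b (inf_eq_left.2 hab))
  have key (x y : A) : n (x ⊓ y) = n x ⊔ n y := by
    apply le_antisymm
    · have h₁ : n (n x ⊔ n y) ≤ x ⊓ y := le_inf
        ((hanti _ _ le_sup_left).trans (hn x).le) ((hanti _ _ le_sup_right).trans (hn y).le)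
      exact (hanti _ _ h₁).trans (hn _).le
    · exact sup_le (hanti _ _ inf_le_left) (hanti _ _ inf_le_right)
  refine ⟨key x y, ?_⟩
  have h₂ := congrArg n (key (n x) (n y))
  rw [hn, hn, hn] at h₂
  exact h₂.symm

theorem IsLatticeAlg.map_meet_of_monotone {A : Type u} {meet join : A → A → A}
    (h : IsLatticeAlg meet join) {n : A → A} (hn : ∀ a, n (n a) = a)
    (ha : ∀ a b, meet a b = a → meet (n a) (n b) = n a) (x y : A) :
    n (meet x y) = meet (n x) (n y) ∧ n (join x y) = join (n x) (n y) := by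
  let _ : Lattice A := h.toLattice
  have hmono (a b : A) (hab : a ≤ b) : n a ≤ n b := inf_eq_left.1 (ha a b (inf_eq_left.2 hab))
  constructor
  · refine le_antisymm (le_inf (hmono _ _ inf_le_left) (hmono _ _ inf_le_right)) ?_
    have h₁ : n (n x ⊓ n y) ≤ x ⊓ y := le_inf
      ((hmono _ _ inf_le_left).trans (hn x).le) ((hmono _ _ inf_le_right).trans (hn y).le)
    exact (hn _).ge.trans (hmono _ _ h₁)
  · refine le_antisymm ?_ (sup_le (hmono _ _ le_sup_left) (hmono _ _ le_sup_right))
    have h₁ : x ⊔ y ≤ n (n x ⊔ n y) := sup_le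
      ((hn x).ge.trans (hmono _ _ le_sup_left)) ((hn y).ge.trans (hmono _ _ le_sup_right))
    exact (hmono _ _ h₁).trans (hn _).le

/-! ### Separation in distributive bilattices -/

section DistributiveBilattice

variable {A : Type u} [Ops A]

/-- Convexity of truth-order ideals in the knowledge order. -/
theorem IsDistributiveBilattice.tor_eq_of_leK (h : IsDistributiveBilattice A) {r s q v : A}
    (hrs : LeK r s) (hsq : LeK s q) (hr : Ops.op .tor v r = v) (hq : Ops.op .tor v q = v) :
    Ops.op .tor v s = v := by
  -- By distributivity `v ∨ ·` preserves the knowledge order, so `v = v ∨ r ≤ₖ v ∨ s ≤ₖ v ∨ q = v`.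
  have h₁ : Ops.op .kand v (Ops.op .tor v s) = v := by
    have := h.distrib .tor .kand (by simp) v r s
    rwa [show Ops.op .kand r s = r from hrs, hr, eq_comm] at this
  have h₂ : Ops.op .kand (Ops.op .tor v s) v = Ops.op .tor v s := by
    have := h.distrib .tor .kand (by simp) v s q
    rwa [show Ops.op .kand s q = s from hsq, hq, eq_comm] at this
  rw [← h₂, h.knowledge_lattice.meet_comm, h₁]

/-- In the knowledge order `x ∧ x'` lies between `x ∧ y'` and `y ∧ x'`, both of which are
truth-below `y ∨ y'`. For a prime truth filter, this forbids leaving it both upwards and downwards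
in the knowledge order. -/
theorem IsDistributiveBilattice.tand_le_tor (h : IsDistributiveBilattice A) {x y x' y' : A}
    (hxy : LeK x y) (hyx : LeK y' x') :
    Ops.op .tor (Ops.op .tor y y') (Ops.op .tand x x') = Ops.op .tor y y' := by
  have hd := h.distrib .tand .kand (by simp)
  have ht := h.truth_lattice
  refine h.tor_eq_of_leK (r := Ops.op .tand x y') (q := Ops.op .tand y x') ?_ ?_ ?_ ?_
  · unfold LeK
    rw [← hd, show Ops.op .kand y' x' = y' from hyx]
  · unfold LeK
    rw [ht.meet_comm x, ht.meet_comm y, ← hd, show Ops.op .kand x y = x from hxy]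
  · rw [ht.join_assoc, ht.meet_comm x, ht.join_meet]
  · rw [ht.join_comm y, ht.join_assoc, ht.join_meet]

theorem IsDistributiveBilattice.isPrimeBifilter (h : IsDistributiveBilattice A) {P : Set A}
    (hand : ∀ x y, Ops.op .tand x y ∈ P ↔ x ∈ P ∧ y ∈ P)
    (hor : ∀ x y, Ops.op .tor x y ∈ P ↔ x ∈ P ∨ y ∈ P)
    (hup : ∀ x y, LeK x y → x ∈ P → y ∈ P) : IsPrimeBifilter P := by
  have ht := h.truth_lattice
  have hk := h.knowledge_lattice
  have hnt := ht.map_meet_of_antitone h.neg_neg h.neg_leT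
  have hnk := hk.map_meet_of_monotone h.neg_neg h.neg_leK
  have hkand (x y : A) : Ops.op .kand x y ∈ P ↔ x ∈ P ∧ y ∈ P := by
    refine ⟨fun hm => ⟨hup _ _ ?_ hm, hup _ _ ?_ hm⟩, fun hm => ?_⟩
    · unfold LeK
      rw [hk.meet_comm x, hk.meet_assoc, hk.meet_self]
    · unfold LeK
      rw [hk.meet_assoc, hk.meet_self]
    · have h₁ : Ops.op .tand (Ops.op .tand x y) (Ops.op .kand x y) = Ops.op .tand x y := by
        rw [h.distrib .tand .kand (by simp), ht.meet_comm _ x, ← ht.meet_assoc, ht.meet_self,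
          ht.meet_assoc, ht.meet_self, hk.meet_self]
      have h₂ := (hand x y).2 hm
      rw [← h₁, hand] at h₂
      exact h₂.2
  have hkor (x y : A) : Ops.op .kor x y ∈ P ↔ x ∈ P ∨ y ∈ P := by
    refine ⟨fun hm => ?_, fun hm => hm.elim (hup _ _ ?_) (hup _ _ ?_)⟩
    · have h₁ : Ops.op .tor (Ops.op .tor x y) (Ops.op .kor x y) = Ops.op .tor x y := by
        rw [h.distrib .tor .kor (by simp), ht.join_comm _ x, ← ht.join_assoc, ht.join_self,
          ht.join_assoc, ht.join_self, hk.join_self]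
      rw [← hor, ← h₁, hor]
      exact Or.inr hm
    · exact hk.meet_join x y
    · unfold LeK
      rw [hk.join_comm, hk.meet_join]
  exact
    { tand := hand
      tor := hor
      kand := hkand
      kor := hkor
      neg_tand := fun a b => by rw [(hnt a b).1, hor]
      neg_tor := fun a b => by rw [(hnt a b).2, hand]
      neg_kand := fun a b => by rw [(hnk a b).1, hkand]
      neg_kor := fun a b => by rw [(hnk a b).2, hkor]
      neg_neg := fun a => by rw [h.neg_neg] }

theorem IsDistributiveBilattice.exists_isPrimeBifilter (h : IsDistributiveBilattice A) {a b : A}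
    (hab : a ≠ b) : ∃ P : Set A, IsPrimeBifilter P ∧
      ¬((a ∈ P ↔ b ∈ P) ∧ (Ops.neg a ∈ P ↔ Ops.neg b ∈ P)) := by
  have ht := h.truth_lattice
  have hnt := ht.map_meet_of_antitone h.neg_neg h.neg_leT
  wlog hle : Ops.op .tand a b ≠ a generalizing a b
  · obtain ⟨P, hP, hs⟩ := this hab.symm (fun hba => hab (by
      rw [← not_not.1 hle, ht.meet_comm, hba]))
    exact ⟨P, hP, fun hc => hs ⟨hc.1.symm, hc.2.symm⟩⟩
  obtain ⟨P, hand, hor, ha, hb⟩ := ht.exists_prime_filter (h.distrib .tand .tor (by simp)) hle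
  by_cases hup : ∀ x y, LeK x y → x ∈ P → y ∈ P
  · exact ⟨P, h.isPrimeBifilter hand hor hup, fun hc => hb (hc.1.1 ha)⟩
  · push Not at hup
    obtain ⟨x, y, hxy, hx, hy⟩ := hup
    -- The pair `x ≤ₖ y` leaves `P` upwards, so by `tand_le_tor` no pair can leave it downwards.
    have hdown (y' x' : A) (hyx : LeK y' x') (hx' : x' ∈ P) : y' ∈ P := by
      by_contra hy'
      have h₁ : Ops.op .tor (Ops.op .tor y y') (Ops.op .tand x x') ∈ P :=
        (hor _ _).2 (Or.inr ((hand _ _).2 ⟨hx, hx'⟩))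
      rw [h.tand_le_tor hxy hyx, hor] at h₁
      exact h₁.elim hy hy'
    -- Negation followed by complement keeps prime truth filters but swaps knowledge down-sets and
    -- up-sets. The new set separates `¬a` from `¬b`.
    refine ⟨{z | Ops.neg z ∉ P}, h.isPrimeBifilter (fun x y => ?_) (fun x y => ?_) ?_, ?_⟩
    · simp only [Set.mem_ofPred_eq, (hnt x y).1, hor, not_or]
    · simp only [Set.mem_ofPred_eq, (hnt x y).2, hand, not_and_or]
    · exact fun x y hxy hx hy => hx (hdown _ _ (h.neg_leK _ _ hxy) hy)
    · simp only [Set.mem_ofPred_eq, h.neg_neg]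
      tauto

end DistributiveBilattice

theorem DBiLat_subset_varietyGenerated : DBiLat.{u} ⊆ varietyGenerated {FOUR.{u}} := by
  rintro A hA K ⟨hK, hF⟩
  let I : Type u := {P : Set A.carrier // IsPrimeBifilter P}
  refine hK.sub A (Alg.prod fun _ : I => FOUR) (fun a P => charMap.{u, u} P.1 a) ?_ ?_
    (hK.prod I _ fun _ => hF rfl)
  · exact ⟨fun c x y => funext fun P => P.2.isHom_charMap.map_op c x y,
      fun x => funext fun P => P.2.isHom_charMap.map_neg x⟩
  · intro a b hab
    by_contra hne
    obtain ⟨P, hP, hs⟩ := IsDistributiveBilattice.exists_isPrimeBifilter hA hne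
    have hP' : charMap.{u, u} P a = charMap.{u, u} P b := congrFun hab (⟨P, hP⟩ : I)
    apply hs
    constructor
    · rw [← charMap_mem_Tr.{u, u} P, hP', charMap_mem_Tr]
    · rw [← neg_charMap_mem_Tr.{u, u} P, hP', neg_charMap_mem_Tr]

theorem DBiLat_subset_AlgLB : DBiLat.{u} ⊆ AlgLB := by
  intro A hA
  refine ⟨{F | IsLBFilter F}, fun S hS => IsLBFilter.sInter hS, fun F hF => hF, ⟨?_, ?_⟩, ?_⟩
  · constructor
    · rintro c x x' y y' rfl rfl
      exact rfl
    · rintro x x' rfl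
      exact rfl
  · rintro F - a b ha rfl
    exact ha
  · rintro θ ⟨hθ, hc⟩ a b hab
    by_contra hne
    obtain ⟨P, hP, hs⟩ := IsDistributiveBilattice.exists_isPrimeBifilter hA hne
    have hiff {x y : A.carrier} (hxy : θ x y) : x ∈ P ↔ y ∈ P :=
      ⟨fun hx => hc P hP.isLBFilter x y hx hxy,
        fun hy => hc P hP.isLBFilter y x hy (θ.symm hxy)⟩
    exact hs ⟨hiff hab, hiff (hθ.neg hab)⟩

theorem AlgStarLB_subset_AlgLB : AlgStarLB.{u} ⊆ AlgLB := by
  rintro A ⟨F, hF, ⟨hc, hcF⟩, hmax⟩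
  refine ⟨{F, Set.univ}, fun S hS => ?_, ?_, ⟨hc, ?_⟩, ?_⟩
  · by_cases hFS : F ∈ S
    · refine Or.inl (Set.Subset.antisymm (Set.sInter_subset_of_mem hFS) ?_)
      refine Set.subset_sInter fun G hG => ?_
      rcases hS hG with rfl | rfl
      · exact subset_rfl
      · exact Set.subset_univ _
    · refine Or.inr (Set.sInter_eq_univ.2 fun G hG => ?_)
      rcases hS hG with rfl | rfl
      · exact absurd hG hFS
      · rfl
  · rintro G (rfl | rfl)
    · exact hF
    · exact isLBFilter_univ
  · rintro G (rfl | rfl)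
    · exact hcF
    · exact fun _ _ _ _ => Set.mem_univ _
  · rintro θ ⟨hθ, hθc⟩
    exact hmax ⟨hθ, hθc F (Or.inl rfl)⟩

/-! ### An algebra that is the reduct of a reduced generalized model only -/

/-- The pairs of elements of `FOUR` that are increasing in the knowledge order. -/
def IncreasingPair : Type u := {z : Four.{u} × Four.{u} // LeK z.1 z.2}

theorem Four.leK_op (c : Conn) {p q p' q' : Four.{u}} (h : LeK p q) (h' : LeK p' q') :
    LeK (Ops.op c p p') (Ops.op c q q') := by
  unfold LeK at *
  cases c <;> cases p <;> cases q <;> cases h <;> cases p' <;> cases q' <;> cases h' <;> rfl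

theorem Four.leK_neg {p q : Four.{u}} (h : LeK p q) : LeK (Ops.neg p) (Ops.neg q) := by
  unfold LeK at *
  cases p <;> cases q <;> cases h <;> rfl

instance instOpsIncreasingPair : Ops IncreasingPair.{u} where
  op c x y := ⟨(Ops.op c x.1.1 y.1.1, Ops.op c x.1.2 y.1.2), Four.leK_op c x.2 y.2⟩
  neg x := ⟨(Ops.neg x.1.1, Ops.neg x.1.2), Four.leK_neg x.2⟩

/-- The nine-element subalgebra of `FOUR × FOUR` of increasing pairs. -/
def increasingPairAlg : Alg.{u} where
  carrier := IncreasingPair.{u}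
  nonempty := ⟨⟨(.bot, .bot), rfl⟩⟩

theorem increasingPairAlg_mem_EqFour : increasingPairAlg.{u} ∈ EqFour := by
  refine isVariety_EqFour.sub _ (Alg.prod fun _ : ULift.{u} Bool => FOUR)
    (fun x i => bif i.down then (x.1.1 : Four.{u}) else (x.1.2 : Four.{u})) ?_ ?_
    (isVariety_EqFour.prod _ _ fun _ => FOUR_mem_EqFour)
  · constructor
    · intro c x y
      funext i
      rcases i with ⟨_ | _⟩ <;> rfl
    · intro x
      funext i
      rcases i with ⟨_ | _⟩ <;> rfl
  · intro x y hxy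
    exact Subtype.ext (Prod.ext (congrFun hxy ⟨true⟩) (congrFun hxy ⟨false⟩))

/-- Lets a filter pass from `x` to `y` using only closure under adding `⊕`- and `∨`-terms. -/
theorem Four.tor_kor_eq {x y : Four.{u}} (h : x ∈ Tr → y ∈ Tr) :
    Ops.op .tor (Ops.op .kor x y) y = y := by
  cases x <;> cases y <;> simp [Tr] at h <;> rfl

theorem Four.leK_mem_Tr {x y : Four.{u}} (h : LeK x y) (hx : x ∈ Tr) : y ∈ Tr := by
  unfold LeK at h
  rw [← h, isPrimeBifilter_Tr.kand] at hx
  exact hx.2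

theorem IsLBFilter.mem_of_increasingPair {F : Set IncreasingPair.{u}} (hF : IsLBFilter F)
    {x y : IncreasingPair.{u}} (hx : x ∈ F) (h₁ : x.1.1 ∈ Tr → y.1.1 ∈ Tr)
    (h₂ : x.1.2 ∈ Tr → y.1.2 ∈ Tr) : y ∈ F := by
  have hm := hF.tor_mem_left (hF.kor_mem_left hx y) y
  have he : Ops.op .tor (Ops.op .kor x y) y = y :=
    Subtype.ext (Prod.ext (Four.tor_kor_eq h₁) (Four.tor_kor_eq h₂))
  rwa [he] at hm

theorem isCongruence_ker {A : Type u} {B : Type v} [Ops A] [Ops B] {h : A → B} (hh : IsHom h) :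
    IsCongruence (Setoid.ker h) := by
  constructor
  · intro c x x' y y' hx hy
    rw [Setoid.ker_def] at *
    rw [hh.map_op, hh.map_op, hx, hy]
  · intro x x' hx
    rw [Setoid.ker_def] at *
    rw [hh.map_neg, hh.map_neg, hx]

/-- Whether the two coordinates are designated takes only three values, the chain `00 < 01 < 11`,
and `F` is the preimage of an up-set of this chain. Failure at the first projection puts some `x`
with first bit `0` in `F`; failure at the second leaves some `y'` with second bit `1` outside `F`.
The bits of `x` are then below those of `y'`, a contradiction. -/
theorem IsLBFilter.compatible_ker_of_increasingPair {F : Set IncreasingPair.{u}}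
    (hF : IsLBFilter F) : Compatible (Setoid.ker fun x : IncreasingPair.{u} => x.1.1) F ∨
      Compatible (Setoid.ker fun x : IncreasingPair.{u} => x.1.2) F := by
  by_contra hcon
  simp only [Compatible, not_or, not_forall, Setoid.ker_def] at hcon
  obtain ⟨⟨x, y, hx, hxy, hy⟩, ⟨x', y', hx', hxy', hy'⟩⟩ := hcon
  have h₁ : x.1.1 ∉ Tr := fun hx₁ => by
    refine hy (hF.mem_of_increasingPair hx (fun _ => hxy ▸ hx₁) fun _ => ?_)
    exact Four.leK_mem_Tr y.2 (hxy ▸ hx₁)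
  have h₂ : y'.1.2 ∈ Tr := by
    by_contra hy₂
    refine hy' (hF.mem_of_increasingPair hx' (fun hx₁ => ?_) fun hx₂ => hxy' ▸ hx₂)
    exact absurd (hxy' ▸ Four.leK_mem_Tr x'.2 hx₁) hy₂
  exact hy' (hF.mem_of_increasingPair hx (fun hx₁ => absurd hx₁ h₁) fun _ => h₂)

theorem increasingPairAlg_notMem_AlgStarLB : increasingPairAlg.{u} ∉ AlgStarLB := by
  rintro ⟨F, hF, -, hmax⟩
  rcases IsLBFilter.compatible_ker_of_increasingPair hF with hc | hc
  · have hle := hmax ⟨isCongruence_ker (h := fun x : IncreasingPair.{u} => x.1.1)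
      ⟨fun _ _ _ => rfl, fun _ => rfl⟩, hc⟩
    -- Distinct increasing pairs with equal first coordinate; the other case uses equal second
    -- coordinates.
    have he : (⟨(.bot, .bot), rfl⟩ : IncreasingPair.{u}) = ⟨(.bot, .top), rfl⟩ := hle rfl
    cases he
  · have hle := hmax ⟨isCongruence_ker (h := fun x : IncreasingPair.{u} => x.1.2)
      ⟨fun _ _ _ => rfl, fun _ => rfl⟩, hc⟩
    have he : (⟨(.bot, .top), rfl⟩ : IncreasingPair.{u}) = ⟨(.top, .top), rfl⟩ := hle rfl
    cases he

end Bilat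

theorem theoremt :
    Bilat.AlgLB.{u} = Bilat.varietyGenerated {Bilat.FOUR.{u}} ∧
    Bilat.varietyGenerated {Bilat.FOUR.{u}} = Bilat.DBiLat.{u} ∧
    Bilat.AlgStarLB.{u} ⊂ Bilat.AlgLB.{u} := by
  have h₁ : Bilat.AlgLB.{u} = Bilat.DBiLat :=
    (Bilat.AlgLB_subset_EqFour.trans Bilat.EqFour_subset_DBiLat).antisymm
      Bilat.DBiLat_subset_AlgLB
  have h₂ : Bilat.varietyGenerated {Bilat.FOUR.{u}} = Bilat.DBiLat :=
    (Bilat.varietyGenerated_subset_EqFour.trans Bilat.EqFour_subset_DBiLat).antisymm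
      Bilat.DBiLat_subset_varietyGenerated
  refine ⟨h₁.trans h₂.symm, h₂, Bilat.AlgStarLB_subset_AlgLB, fun hsub => ?_⟩
  apply Bilat.increasingPairAlg_notMem_AlgStarLB
  apply hsub
  rw [h₁]
  exact Bilat.EqFour_subset_DBiLat Bilat.increasingPairAlg_mem_EqFour
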